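/- Let $\mathcal S,\mathcal T\subseteq\mathbb R$ be closed intervals, each with more than one point, and let $\mu\in L^2(\mathcal S\times\mathcal T)$ be real-valued. Put $k_1(s_1,s_2)=\int_{\mathcal T}\mu(s_1,t)\mu(s_2,t)\,dt$ and $k_2(t_1,t_2)=\int_{\mathcal S}\mu(s,t_1)\mu(s,t_2)\,ds$. A functional singular value decomposition (FSVD) of $\mu$ consists of a finite (possibly empty) or infinite non-increasing sequence of positive numbers $\lambda_k$, an orthonormal sequence $\{\phi_k\}$ in $L^2(\mathcal S)$ and an orthonormal sequence $\{\psi_k\}$ in $L^2(\mathcal T)$, all three of the same length, such that $\int_{\mathcal S}k_1(s,u)\phi_k(u)\,du=\lambda_k\phi_k(s)$ for almost every $s\in\mathcal S$, $\int_{\mathcal T}k_2(t,u)\psi_k(u)\,du=\lambda_k\psi_k(t)$ for almost every $t\in\mathcal T$, and $$k_1(s_1,s_2)=\sum_{k\ge1}\lambda_k\phi_k(s_1)\phi_k(s_2),\quad k_2(t_1,t_2)=\sum_{k\ge1}\lambda_k\psi_k(t_1)\psi_k(t_2),\quad \mu(s,t)=\sum_{k\ge1}\lambda_k^{1/2}\phi_k(s)\psi_k(t),$$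 where the series converge in the $L^2$ norm. Then $\mu$ has an FSVD. Moreover, for every FSVD of $\mu$ and every integer $p\ge0$, let $\mu^{(p)}(s,t)=\sum_{k=1}^{p}\lambda_k^{1/2}\phi_k(s)\psi_k(t)$ (the sum of all terms if there are fewer than $p$ of them), and let $\mathcal H_p$ be the class of functions $h(s,t)=\sum_{k=1}^p a_k f_k(t)g_k(s)$ with $a_k\in\mathbb R$ and with $f_1,\dots,f_p$ orthonormal in $L^2(\mathcal T)$ and $g_1,\dots,g_p$ orthonormal in $L^2(\mathcal S)$. Then $\mu^{(p)}\in\mathcal H_p$ and $$\min_{h\in\mathcal H_p}\|\mu-h\|^2=\|\mu-\mu^{(p)}\|^2,$$ where $\|\cdot\|$ is the norm of $L^2(\mathcal S\times\mathcal T)$ and the minimum is attained. -/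

import Mathlib

open MeasureTheory Filter Topology

noncomputable section

namespace FSVD

/-- Lebesgue measure on `S ⊆ ℝ`. -/
abbrev vol (S : Set ℝ) : Measure ℝ := volume.restrict S

/-- Lebesgue measure on `S × T`. -/
abbrev vol₂ (S T : Set ℝ) : Measure (ℝ × ℝ) := (vol S).prod (vol T)

/-- The real Hilbert space `L²(S)`. -/
abbrev L2 (S : Set ℝ) : Type := Lp ℝ 2 (vol S)

/-- The real Hilbert space `L²(S × T)`. -/
abbrev L2₂ (S T : Set ℝ) : Type := Lp ℝ 2 (vol₂ S T)

theorem memLp_tensor {S T : Set ℝ} (g : L2 S) (f : L2 T) :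
    MemLp (fun z : ℝ × ℝ => g z.1 * f z.2) 2 (vol₂ S T) := by
  have hg := Lp.memLp g
  have hf := Lp.memLp f
  have hm : AEStronglyMeasurable (fun z : ℝ × ℝ => g z.1 * f z.2) (vol₂ S T) :=
    hg.1.comp_fst.mul hf.1.comp_snd
  rw [memLp_two_iff_integrable_sq hm]
  have h := hg.integrable_sq.mul_prod hf.integrable_sq
  refine h.congr (Eventually.of_forall fun z => ?_)
  simp only [mul_pow]

/-- The function of separate variables `(s, t) ↦ g(s) f(t)`, as an element of `L²(S × T)`. -/
def tensor {S T : Set ℝ} (g : L2 S) (f : L2 T) : L2₂ S T := (memLp_tensor g f).toLp _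

/-- `k₁(s₁, s₂) = ∫_T μ(s₁, t) μ(s₂, t) dt`. -/
def kernel₁ {S T : Set ℝ} (μ : L2₂ S T) (s₁ s₂ : ℝ) : ℝ := ∫ t in T, μ (s₁, t) * μ (s₂, t)

/-- `k₂(t₁, t₂) = ∫_S μ(s, t₁) μ(s, t₂) ds`. -/
def kernel₂ {S T : Set ℝ} (μ : L2₂ S T) (t₁ t₂ : ℝ) : ℝ := ∫ s in S, μ (s, t₁) * μ (s, t₂)

/-- The integral equation `∫_S k(s, u) φ(u) du = l φ(s)` for almost every `s ∈ S`.
An eigenfunction of `k` with eigenvalue `l` is a solution `φ ≠ 0`. -/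
def EigenEq {S : Set ℝ} (k : ℝ → ℝ → ℝ) (l : ℝ) (φ : L2 S) : Prop :=
  ∀ᵐ s ∂(vol S), ∫ u in S, k s u * φ u = l * φ s

/-- The indices `k < n` that are smaller than the (finite or infinite) number `N` of terms. -/
def indices (N : ℕ∞) (n : ℕ) : Finset ℕ := {k ∈ Finset.range n | (k : ℕ∞) < N}

/-- The truncated series `μ⁽ᵖ⁾ = ∑_{k ≤ p} l_k^{1/2} φ_k(s) ψ_k(t)`; if the sequence has only
`N < p` terms, it is the sum of all of them. Indices start at `0`. -/
def truncation {S T : Set ℝ} (N : ℕ∞) (l : ℕ → ℝ) (φ : ℕ → L2 S) (ψ : ℕ → L2 T) (p : ℕ) :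
    L2₂ S T :=
  ∑ k ∈ indices N p, √(l k) • tensor (φ k) (ψ k)

/-- `(l_k)`, `(φ_k)`, `(ψ_k)`, with `N` terms (`N` finite or infinite), form a functional singular
value decomposition of `μ`. The values at indices `k ≥ N` are irrelevant. -/
structure IsFSVD {S T : Set ℝ} (μ : L2₂ S T)
    (N : ℕ∞) (l : ℕ → ℝ) (φ : ℕ → L2 S) (ψ : ℕ → L2 T) : Prop where
  pos : ∀ k : ℕ, (k : ℕ∞) < N → 0 < l k
  noninc : ∀ j k : ℕ, j ≤ k → (k : ℕ∞) < N → l k ≤ l j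
  orthonormal_left : Orthonormal ℝ (fun k : {k : ℕ // (k : ℕ∞) < N} => φ k)
  orthonormal_right : Orthonormal ℝ (fun k : {k : ℕ // (k : ℕ∞) < N} => ψ k)
  eigen_left : ∀ k : ℕ, (k : ℕ∞) < N → EigenEq (kernel₁ μ) (l k) (φ k)
  eigen_right : ∀ k : ℕ, (k : ℕ∞) < N → EigenEq (kernel₂ μ) (l k) (ψ k)
  expansion_kernel₁ : Tendsto (fun n : ℕ => eLpNorm (fun z : ℝ × ℝ =>
      kernel₁ μ z.1 z.2 - ∑ k ∈ indices N n, l k * φ k z.1 * φ k z.2) 2 (vol₂ S S)) atTop (𝓝 0)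
  expansion_kernel₂ : Tendsto (fun n : ℕ => eLpNorm (fun z : ℝ × ℝ =>
      kernel₂ μ z.1 z.2 - ∑ k ∈ indices N n, l k * ψ k z.1 * ψ k z.2) 2 (vol₂ T T)) atTop (𝓝 0)
  expansion : Tendsto (truncation N l φ ψ) atTop (𝓝 μ)

/-- The class `H_p` of the functions `h(s, t) = ∑_{k ≤ p} a_k f_k(t) g_k(s)` with `(f_k)`
orthonormal in `L²(T)` and `(g_k)` orthonormal in `L²(S)`. -/
def separable (S T : Set ℝ) (p : ℕ) : Set (L2₂ S T) :=
  {h | ∃ (a : Fin p → ℝ) (f : Fin p → L2 T) (g : Fin p → L2 S),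
    Orthonormal ℝ f ∧ Orthonormal ℝ g ∧ h = ∑ k, a k • tensor (g k) (f k)}

end FSVD

end

/-!
The argument is Hilbert space theory on top of two facts about the tensor product `tensor g f`:
it is bilinear with `⟪g ⊗ f, g' ⊗ f'⟫ = ⟪g, g'⟫ ⟪f, f'⟫`, and no nonzero element of `L²(S × T)` is
orthogonal to all tensors (`inner_tensor_tensor`, `eq_zero_of_inner_tensor_eq_zero`).

*Existence.* By totality, `ν` is a limit of finite sums of tensors, so that the form
`(g, f) ↦ ⟪ν, g ⊗ f⟫` defines a compact operator and attains its norm `σ` at unit vectors `g`, `f`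
(`exists_singular_triple_of_isCompactOperator`). Subtracting `σ • g ⊗ f` leaves a residue that
vanishes on `g ⊗ ·` and on `· ⊗ f`. Iterating gives orthonormal systems and non-increasing `σ k`.
By Pythagoras the residues converge and `σ k → 0`; the limit is orthogonal to all tensors, hence
zero (`exists_singular_expansion`). The expansions of the two kernels follow because contracting
two functions along a common variable is continuous in `L²` (`tendsto_eLpNorm_kernel_sub`), and the
eigenvalue equations follow from the kernel expansions (`eigenEq_of_tendsto`).

*Optimality.* For `h = ∑ j, a j • g j ⊗ f j` and a finite expansion `x = ∑ k, √(l k) • φ k ⊗ ψ k`,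
completing the square gives `‖x - h‖² ≥ ‖x‖² - ∑ j, ⟪x, g j ⊗ f j⟫²`. By Cauchy–Schwarz and Bessel
the last sum is at most `∑ k, l k * w k` with weights `w k = ∑ j, ⟪φ k, g j⟫² ∈ [0, 1]` of total
mass at most `p`, hence at most the sum of the `p` largest `l k` (`sum_sub_sum_le_norm_sub_sq`). A
limit gives the bound for `μ` (`norm_sub_sum_sq_le`). That the truncation belongs to the class when
there are fewer than `p` terms uses that `L²` of a nondegenerate interval is infinite-dimensional.
-/

namespace FSVD

open scoped InnerProductSpace ENNReal

/-! ### Maximizing pairs and the singular expansion -/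

section Abstract

variable {H K X : Type*}
  [NormedAddCommGroup H] [InnerProductSpace ℝ H]
  [NormedAddCommGroup K] [InnerProductSpace ℝ K]
  [NormedAddCommGroup X] [InnerProductSpace ℝ X]

/-- A functional that attains its norm `c` at the unit vector `f` is `c • ⟪f, ·⟫`. -/
theorem eq_mul_inner_of_le_of_eq [CompleteSpace K] (L : K →L[ℝ] ℝ) {c : ℝ} {f : K}
    (hL : ∀ x, L x ≤ c * ‖x‖) (hf : ‖f‖ = 1) (hLf : L f = c) (x : K) : L x = c * ⟪f, x⟫_ℝ := by
  set v := (InnerProductSpace.toDual ℝ K).symm L with hv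
  have hvx : ∀ x, ⟪v, x⟫_ℝ = L x := fun x => InnerProductSpace.toDual_symm_apply
  have h1 : ‖v‖ ^ 2 ≤ c * ‖v‖ := by
    rw [← real_inner_self_eq_norm_sq, hvx]; exact hL v
  have h2 : ‖v - c • f‖ ^ 2 = ‖v‖ ^ 2 - c ^ 2 := by
    rw [norm_sub_sq_real, inner_smul_right, hvx, hLf, norm_smul, hf, Real.norm_eq_abs, mul_one,
      sq_abs]
    ring
  have h3 : ‖v‖ ^ 2 ≤ c ^ 2 := by
    rcases (norm_nonneg v).eq_or_lt with h | h
    · rw [← h, zero_pow two_ne_zero]; exact sq_nonneg c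
    · have : ‖v‖ ≤ c := by nlinarith
      exact pow_le_pow_left₀ h.le this 2
  have h4 : v - c • f = 0 := by
    rw [← norm_eq_zero, ← sq_eq_zero_iff]
    exact le_antisymm (by linarith) (by positivity)
  rw [← hvx, sub_eq_zero.1 h4, real_inner_smul_left]

/-- The bounded operator `f ↦ ⟪ν, B · f⟫` from `K` to the dual of `H`. When `B` is the tensor
product of `L²` spaces this is the integral operator with kernel `ν`. -/
noncomputable def kernelOp (B : H →L[ℝ] K →L[ℝ] X) (ν : X) : K →L[ℝ] (H →L[ℝ] ℝ) :=
  (ContinuousLinearMap.compL ℝ H X ℝ (innerSL ℝ ν)).comp B.flip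

@[simp]
theorem kernelOp_apply (B : H →L[ℝ] K →L[ℝ] X) (ν : X) (f : K) (g : H) :
    kernelOp B ν f g = ⟪ν, B g f⟫_ℝ := rfl

/-- The `ν` with compact `kernelOp B ν` form a closed subspace that contains all `B g f`, since
these give operators of rank one. -/
theorem isCompactOperator_kernelOp [CompleteSpace X] (B : H →L[ℝ] K →L[ℝ] X)
    (hB : ∀ g f g' f', ⟪B g f, B g' f'⟫_ℝ = ⟪g, g'⟫_ℝ * ⟪f, f'⟫_ℝ)
    (htot : ∀ ν, (∀ g f, ⟪ν, B g f⟫_ℝ = 0) → ν = 0) (ν : X) :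
    IsCompactOperator (kernelOp B ν) := by
  let V : Submodule ℝ X :=
    { carrier := {ν | IsCompactOperator (kernelOp B ν)}
      add_mem' := fun {a b} ha hb => by
        have : kernelOp B (a + b) = kernelOp B a + kernelOp B b := by
          ext; simp [inner_add_left]
        simp only [Set.mem_ofPred_eq, this]
        exact ha.add hb
      zero_mem' := by
        have : kernelOp B (0 : X) = 0 := by ext; simp
        simp only [Set.mem_ofPred_eq, this]
        exact isCompactOperator_zero
      smul_mem' := fun c a ha => by
        have : kernelOp B (c • a) = c • kernelOp B a := by
          ext; simp [real_inner_smul_left]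
        simp only [Set.mem_ofPred_eq, this]
        exact ha.smul c }
  have hcont : Continuous (kernelOp B) := by
    unfold kernelOp
    fun_prop
  have hclosed : IsClosed (V : Set X) := isClosed_setOfPred_isCompactOperator.preimage hcont
  have hmem : ∀ g f, B g f ∈ V := by
    intro g f
    have : kernelOp B (B g f) = (innerSL ℝ f).smulRight (innerSL ℝ g) := by
      ext f' g'
      simp [hB, mul_comm]
    change IsCompactOperator (kernelOp B (B g f))
    rw [this]
    exact (isCompactOperator_of_locallyCompactSpace_dom (innerSL ℝ f)).clm_comp
      ((ContinuousLinearMap.id ℝ ℝ).smulRight (innerSL ℝ g))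
  have htop : V = ⊤ := by
    have : CompleteSpace V := hclosed.completeSpace_coe
    rw [← Submodule.orthogonal_eq_bot_iff, eq_bot_iff]
    intro x hx
    rw [Submodule.mem_bot]
    exact htot x fun g f => (Submodule.mem_orthogonal' _ _).1 hx _ (hmem g f)
  exact (htop ▸ Submodule.mem_top : ν ∈ V)

/-- A compact bilinear form attains its norm `σ` on the unit spheres, and at a maximizing pair
`(g, f)` it is `σ` times the inner product in each variable separately. For the zero form `σ = 0`
and the vectors need not be unit vectors, since the spaces may be trivial. -/
theorem exists_singular_triple_of_isCompactOperator [CompleteSpace H] [CompleteSpace K]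
    (A : K →L[ℝ] H →L[ℝ] ℝ) (hA : IsCompactOperator A) :
    ∃ (σ : ℝ) (g : H) (f : K), 0 ≤ σ ∧ (∀ g' f', A f' g' ≤ σ * ‖g'‖ * ‖f'‖) ∧
      (0 < σ → ‖g‖ = 1 ∧ ‖f‖ = 1) ∧
      (∀ f', A f' g = σ * ⟪f, f'⟫_ℝ) ∧ (∀ g', A f g' = σ * ⟪g, g'⟫_ℝ) := by
  by_cases h0 : A = 0
  · subst h0
    exact ⟨0, 0, 0, le_rfl, by simp, by simp, by simp, by simp⟩
  have hpos : 0 < ‖A‖ := (norm_pos_iff (a := A)).2 h0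
  have hbound : ∀ g' f', A f' g' ≤ ‖A‖ * ‖g'‖ * ‖f'‖ := by
    intro g' f'
    calc A f' g' ≤ ‖A f' g'‖ := le_abs_self _
      _ ≤ ‖A‖ * ‖f'‖ * ‖g'‖ := A.le_opNorm₂ f' g'
      _ = _ := by ring
  generalize hσ : ‖A‖ = σ at hpos hbound
  -- the norm attains its maximum `σ` on the compact closure of the image of the unit ball
  have hC : IsCompact (closure (A '' Metric.closedBall 0 1)) :=
    IsCompactOperator.isCompact_closure_image_closedBall (f := (A : K →ₗ[ℝ] H →L[ℝ] ℝ)) hA 1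
  obtain ⟨y, hyC, hymax⟩ := hC.exists_isMaxOn
    ⟨A 0, subset_closure ⟨0, by simp, rfl⟩⟩ continuous_norm.continuousOn
  have hle : ∀ f : K, ‖f‖ ≤ 1 → ‖A f‖ ≤ ‖y‖ := fun f hf =>
    hymax (subset_closure ⟨f, by simpa using hf, rfl⟩)
  have hy1 : σ ≤ ‖y‖ := by
    rw [← hσ]
    exact A.opNorm_le_of_unit_norm (norm_nonneg _) fun f hf => hle f hf.le
  have hy2 : ‖y‖ ≤ σ := by
    refine closure_minimal (t := Metric.closedBall 0 σ) ?_ Metric.isClosed_closedBall hyC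
      |> mem_closedBall_zero_iff.1
    rintro _ ⟨f, hf, rfl⟩
    rw [mem_closedBall_zero_iff] at hf ⊢
    exact (A.le_of_opNorm_le hσ.le f).trans (mul_le_of_le_one_right hpos.le hf)
  have hy : ‖y‖ = σ := le_antisymm hy2 hy1
  obtain ⟨u, rfl⟩ := (InnerProductSpace.toDual ℝ H).surjective y
  rw [LinearIsometryEquiv.norm_map] at hy
  obtain ⟨w, hw⟩ := (InnerProductSpace.toDual ℝ K).surjective (A.flip u)
  have hwx : ∀ x, ⟪w, x⟫_ℝ = A x u := fun x => by
    rw [← ContinuousLinearMap.flip_apply, ← hw, InnerProductSpace.toDual_apply_apply]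
  have hw1 : ‖w‖ ≤ σ ^ 2 := by
    have h : ‖w‖ ^ 2 ≤ σ ^ 2 * ‖w‖ := by
      rw [← real_inner_self_eq_norm_sq, hwx]
      refine (hbound u w).trans_eq ?_
      rw [hy]; ring
    by_contra! hlt
    nlinarith [norm_nonneg w, sq_nonneg σ]
  have hw2 : σ ^ 2 ≤ ‖w‖ := by
    have hcl : IsClosed ((fun z : H →L[ℝ] ℝ => z u) ⁻¹' Set.Iic ‖w‖) :=
      isClosed_Iic.preimage (by fun_prop)
    have h : InnerProductSpace.toDual ℝ H u u ≤ ‖w‖ := by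
      refine closure_minimal ?_ hcl hyC
      rintro _ ⟨f, hf, rfl⟩
      rw [mem_closedBall_zero_iff] at hf
      rw [Set.mem_preimage, Set.mem_Iic, ← hwx]
      exact (real_inner_le_norm w f).trans (mul_le_of_le_one_right (norm_nonneg _) hf)
    rwa [InnerProductSpace.toDual_apply_apply, real_inner_self_eq_norm_sq, hy] at h
  have hwn : ‖w‖ = σ ^ 2 := le_antisymm hw1 hw2
  have hgn : ‖σ⁻¹ • u‖ = 1 := by
    rw [norm_smul, hy, norm_inv, Real.norm_of_nonneg hpos.le, inv_mul_cancel₀ hpos.ne']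
  have hfn : ‖(σ ^ 2)⁻¹ • w‖ = 1 := by
    rw [norm_smul, hwn, norm_inv, Real.norm_of_nonneg (by positivity),
      inv_mul_cancel₀ (by positivity)]
  have hval : A ((σ ^ 2)⁻¹ • w) (σ⁻¹ • u) = σ := by
    have h : A w u = σ ^ 4 := by
      rw [← hwx, real_inner_self_eq_norm_sq, hwn]; ring
    simp only [map_smul, smul_apply, smul_eq_mul, h]
    field_simp
  refine ⟨σ, σ⁻¹ • u, (σ ^ 2)⁻¹ • w, hpos.le, hbound, fun _ => ⟨hgn, hfn⟩, ?_, ?_⟩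
  · refine eq_mul_inner_of_le_of_eq (A.flip (σ⁻¹ • u)) (fun x => ?_) hfn hval
    have := hbound (σ⁻¹ • u) x
    rwa [hgn, mul_one] at this
  · refine eq_mul_inner_of_le_of_eq (A ((σ ^ 2)⁻¹ • w)) (fun x => ?_) hgn hval
    have := hbound x ((σ ^ 2)⁻¹ • w)
    rwa [hfn, mul_one] at this

/-- The singular value expansion, by successive deflation. Where `σ k = 0` nothing is said
about the norms of `φ k` and `ψ k`; those terms of the series vanish. -/
theorem exists_singular_expansion [CompleteSpace H] [CompleteSpace K] [CompleteSpace X]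
    (B : H →L[ℝ] K →L[ℝ] X)
    (hB : ∀ g f g' f', ⟪B g f, B g' f'⟫_ℝ = ⟪g, g'⟫_ℝ * ⟪f, f'⟫_ℝ)
    (htot : ∀ ν, (∀ g f, ⟪ν, B g f⟫_ℝ = 0) → ν = 0) (μ : X) :
    ∃ (σ : ℕ → ℝ) (φ : ℕ → H) (ψ : ℕ → K), (∀ k, 0 ≤ σ k) ∧ Antitone σ ∧
      (∀ k, 0 < σ k → ‖φ k‖ = 1 ∧ ‖ψ k‖ = 1) ∧
      (∀ i j, i < j → 0 < σ j → ⟪φ i, φ j⟫_ℝ = 0 ∧ ⟪ψ i, ψ j⟫_ℝ = 0) ∧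
      Tendsto (fun n => ∑ k ∈ Finset.range n, σ k • B (φ k) (ψ k)) atTop (𝓝 μ) := by
  choose s g f hs hbd hn hg hf using fun ν =>
    exists_singular_triple_of_isCompactOperator _ (isCompactOperator_kernelOp B hB htot ν)
  simp only [kernelOp_apply] at hbd hg hf
  let ν : ℕ → X := fun n => Nat.rec μ (fun _ v => v - s v • B (g v) (f v)) n
  have hν : ∀ n, ν (n + 1) = ν n - s (ν n) • B (g (ν n)) (f (ν n)) := fun n => rfl
  -- the diagonal terms `σ ‖g‖²` equal `σ`, also when `σ = 0`
  have hsg : ∀ v, s v * ⟪g v, g v⟫_ℝ = s v := fun v => by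
    rcases (hs v).eq_or_lt with h | h
    · rw [← h, zero_mul]
    · rw [real_inner_self_eq_norm_sq, (hn v h).1]; ring
  have hsf : ∀ v, s v * ⟪f v, f v⟫_ℝ = s v := fun v => by
    rcases (hs v).eq_or_lt with h | h
    · rw [← h, zero_mul]
    · rw [real_inner_self_eq_norm_sq, (hn v h).2]; ring
  have hstep : ∀ n g' f', ⟪ν (n + 1), B g' f'⟫_ℝ =
      ⟪ν n, B g' f'⟫_ℝ - s (ν n) * (⟪g (ν n), g'⟫_ℝ * ⟪f (ν n), f'⟫_ℝ) := fun n g' f' => by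
    rw [hν, inner_sub_left, real_inner_smul_left, hB]
  -- deflation: `ν n` vanishes in the directions already split off
  have hkill : ∀ n i, i < n → (∀ f', ⟪ν n, B (g (ν i)) f'⟫_ℝ = 0) ∧
      (∀ g', ⟪ν n, B g' (f (ν i))⟫_ℝ = 0) := by
    intro n
    induction n with
    | zero => intro i hi; omega
    | succ n ih =>
      intro i hi
      rcases Nat.lt_succ_iff_lt_or_eq.1 hi with hi | rfl
      · have h1 : s (ν n) * ⟪g (ν n), g (ν i)⟫_ℝ = 0 := by
          rw [← hf, (ih i hi).1]
        have h2 : s (ν n) * ⟪f (ν n), f (ν i)⟫_ℝ = 0 := by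
          rw [← hg, (ih i hi).2]
        refine ⟨fun f' => ?_, fun g' => ?_⟩
        · rw [hstep, (ih i hi).1, ← mul_assoc, h1]; ring
        · rw [hstep, (ih i hi).2, mul_left_comm, h2]; ring
      · refine ⟨fun f' => ?_, fun g' => ?_⟩
        · rw [hstep, hg, ← mul_assoc, hsg]; ring
        · rw [hstep, hf, mul_left_comm, hsf]; ring
  have horth : ∀ i j, i < j → 0 < s (ν j) →
      ⟪g (ν i), g (ν j)⟫_ℝ = 0 ∧ ⟪f (ν i), f (ν j)⟫_ℝ = 0 := by
    intro i j hij hj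
    constructor
    · have := hf (ν j) (g (ν i))
      rw [(hkill j i hij).1, real_inner_comm] at this
      exact (mul_eq_zero.1 this.symm).resolve_left hj.ne'
    · have := hg (ν j) (f (ν i))
      rw [(hkill j i hij).2, real_inner_comm] at this
      exact (mul_eq_zero.1 this.symm).resolve_left hj.ne'
  have hanti : Antitone fun n => s (ν n) := by
    refine antitone_nat_of_succ_le fun n => ?_
    rcases (hs (ν (n + 1))).eq_or_lt with h | h
    · rw [← h]; exact hs _
    · have ho := horth n (n + 1) n.lt_succ_self h
      have h1 := hf (ν (n + 1)) (g (ν (n + 1)))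
      rw [hsg, hstep, ho.1, zero_mul, mul_zero, sub_zero] at h1
      have h2 := hbd (ν n) (g (ν (n + 1))) (f (ν (n + 1)))
      rwa [h1, (hn _ h).1, (hn _ h).2, mul_one, mul_one] at h2
  have hsum : ∀ n, ∑ k ∈ Finset.range n, s (ν k) • B (g (ν k)) (f (ν k)) = μ - ν n := by
    intro n
    induction n with
    | zero => simp [ν]
    | succ n ih => rw [Finset.sum_range_succ, ih, hν]; abel
  -- `ν n` is orthogonal to the part `μ - ν n` split off before
  have hperp : ∀ m n, m ≤ n → ⟪ν n, ν m - ν n⟫_ℝ = 0 := by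
    intro m n hmn
    have : ν m - ν n = ∑ k ∈ Finset.Ico m n, s (ν k) • B (g (ν k)) (f (ν k)) := by
      rw [Finset.sum_Ico_eq_sub _ hmn, hsum, hsum]; abel
    rw [this, inner_sum]
    refine Finset.sum_eq_zero fun k hk => ?_
    rw [real_inner_smul_right, (hkill n k (Finset.mem_Ico.1 hk).2).1, mul_zero]
  have hpyth : ∀ m n, m ≤ n → ‖ν m - ν n‖ ^ 2 = ‖ν m‖ ^ 2 - ‖ν n‖ ^ 2 := by
    intro m n hmn
    have h := norm_add_sq_real (ν n) (ν m - ν n)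
    rw [hperp m n hmn, add_sub_cancel] at h
    linarith
  have hnsq : Antitone fun n => ‖ν n‖ ^ 2 := fun m n hmn => by
    have := hpyth m n hmn
    have := sq_nonneg ‖ν m - ν n‖
    change ‖ν n‖ ^ 2 ≤ ‖ν m‖ ^ 2
    linarith
  obtain ⟨c, hc⟩ : ∃ c, Tendsto (fun n => ‖ν n‖ ^ 2) atTop (𝓝 c) :=
    ⟨_, tendsto_atTop_ciInf hnsq ⟨0, by rintro _ ⟨n, rfl⟩; positivity⟩⟩
  have hcauchy : CauchySeq ν := by
    rw [Metric.cauchySeq_iff']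
    intro ε hε
    have hc' := Metric.cauchySeq_iff'.1 hc.cauchySeq (ε ^ 2) (by positivity)
    obtain ⟨M, hM⟩ := hc'
    refine ⟨M, fun n hn => ?_⟩
    have h1 := hM n hn
    rw [Real.dist_eq, abs_lt] at h1
    have h2 := hpyth M n hn
    rw [dist_comm, dist_eq_norm]
    exact lt_of_pow_lt_pow_left₀ 2 hε.le (by linarith)
  obtain ⟨ν', hν'⟩ := cauchySeq_tendsto_of_complete hcauchy
  have hszero : Tendsto (fun n => s (ν n)) atTop (𝓝 0) := by
    have h1 : Tendsto (fun n => ‖ν n‖ ^ 2 - ‖ν (n + 1)‖ ^ 2) atTop (𝓝 0) := by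
      simpa using hc.sub (hc.comp (tendsto_add_atTop_nat 1))
    have h2 : ∀ n, ‖ν n‖ ^ 2 - ‖ν (n + 1)‖ ^ 2 = s (ν n) ^ 2 := by
      intro n
      have h3 : ν n - ν (n + 1) = s (ν n) • B (g (ν n)) (f (ν n)) := by rw [hν]; abel
      rw [← hpyth n (n + 1) n.le_succ, h3, ← real_inner_self_eq_norm_sq, real_inner_smul_left,
        real_inner_smul_right, hB]
      linear_combination s (ν n) * ⟪f (ν n), f (ν n)⟫_ℝ * hsg (ν n) + s (ν n) * hsf (ν n)
    simp only [h2] at h1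
    have h4 := h1.sqrt
    simpa [Real.sqrt_sq (hs _)] using h4
  have hν'0 : ν' = 0 := by
    have hle : ∀ g' f', ⟪ν', B g' f'⟫_ℝ ≤ 0 := fun g' f' => by
      have h1 : Tendsto (fun n => ⟪ν n, B g' f'⟫_ℝ) atTop (𝓝 ⟪ν', B g' f'⟫_ℝ) :=
        hν'.inner tendsto_const_nhds
      have h2 : Tendsto (fun n => s (ν n) * ‖g'‖ * ‖f'‖) atTop (𝓝 0) := by
        simpa using (hszero.mul_const ‖g'‖).mul_const ‖f'‖
      exact le_of_tendsto_of_tendsto' h1 h2 fun n => hbd _ _ _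
    refine htot ν' fun g' f' => le_antisymm (hle g' f') ?_
    have := hle (-g') f'
    simp only [map_neg, neg_apply, inner_neg_right] at this
    linarith
  refine ⟨fun n => s (ν n), fun n => g (ν n), fun n => f (ν n), fun k => hs _, hanti,
    fun k => hn _, horth, ?_⟩
  simp only [hsum]
  simpa [hν'0] using (tendsto_const_nhds (x := μ)).sub hν'

/-- Weights in `[0, 1]` of total mass at most `p` capture no more of `l` than the index set `J` of
`p` largest values; the threshold `c` separates the values on `J` from the others. -/
theorem sum_mul_le_sum_of_weights {l w : ℕ → ℝ} {I J : Finset ℕ} {p : ℕ} {c : ℝ} (hJI : J ⊆ I)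
    (hw0 : ∀ k ∈ I, 0 ≤ w k) (hw1 : ∀ k ∈ I, w k ≤ 1) (hwp : ∑ k ∈ I, w k ≤ p)
    (hcard : J.card = p) (hc0 : 0 ≤ c) (hcJ : ∀ k ∈ J, c ≤ l k) (hcI : ∀ k ∈ I \ J, l k ≤ c) :
    ∑ k ∈ I, l k * w k ≤ ∑ k ∈ J, l k := by
  have h1 : ∑ k ∈ I \ J, l k * w k ≤ c * ∑ k ∈ I \ J, w k := by
    rw [Finset.mul_sum]
    exact Finset.sum_le_sum fun k hk =>
      mul_le_mul_of_nonneg_right (hcI k hk) (hw0 k (Finset.mem_sdiff.1 hk).1)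
  have h2 : c * ∑ k ∈ J, (1 - w k) ≤ ∑ k ∈ J, l k * (1 - w k) := by
    rw [Finset.mul_sum]
    exact Finset.sum_le_sum fun k hk =>
      mul_le_mul_of_nonneg_right (hcJ k hk) (by linarith [hw1 k (hJI hk)])
  have h3 := Finset.sum_sdiff (f := fun k => l k * w k) hJI
  have h4 := Finset.sum_sdiff (f := w) hJI
  simp only [mul_sub, mul_one, Finset.sum_sub_distrib, Finset.sum_const, nsmul_eq_mul, hcard]
    at h2
  have h5 : c * (∑ k ∈ I \ J, w k + ∑ k ∈ J, w k) ≤ c * p := by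
    rw [h4]; exact mul_le_mul_of_nonneg_left hwp hc0
  linarith

end Abstract

/-! ### Best approximation and prolongation of orthonormal systems -/

section Approximation

variable {H K X : Type*}
  [NormedAddCommGroup H] [InnerProductSpace ℝ H]
  [NormedAddCommGroup K] [InnerProductSpace ℝ K]
  [NormedAddCommGroup X] [InnerProductSpace ℝ X]

theorem orthonormal_bilin {ι : Type*} {B : H →L[ℝ] K →L[ℝ] X}
    (hB : ∀ g f g' f', ⟪B g f, B g' f'⟫_ℝ = ⟪g, g'⟫_ℝ * ⟪f, f'⟫_ℝ)
    {φ : ι → H} {ψ : ι → K} (hφ : Orthonormal ℝ φ) (hψ : Orthonormal ℝ ψ) :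
    Orthonormal ℝ fun k => B (φ k) (ψ k) := by
  classical
  rw [orthonormal_iff_ite] at *
  intro i j
  rw [hB, hφ, hψ]
  split_ifs <;> simp

theorem norm_sq_sum_sqrt_smul {I : Finset ℕ} {l : ℕ → ℝ} {v : ℕ → X} (hl : ∀ k ∈ I, 0 ≤ l k)
    (hv : Orthonormal ℝ fun k : I => v k) : ‖∑ k ∈ I, √(l k) • v k‖ ^ 2 = ∑ k ∈ I, l k := by
  rw [← real_inner_self_eq_norm_sq, ← Finset.sum_coe_sort I (fun k => √(l k) • v k),
    hv.inner_sum (fun k => √(l k)) (fun k => √(l k)) Finset.univ, ← Finset.sum_coe_sort I l]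
  exact Finset.sum_congr rfl fun k _ => Real.mul_self_sqrt (hl k k.2)

/-- The Eckart–Young lower bound for a finite singular value expansion: completing the square in
the coefficients `a` leaves `∑ j, c j ^ 2`, where `c j = ⟪x, B (g j) (f j)⟫`, and Cauchy–Schwarz
and Bessel bound it by `∑ k, l k * w k` with weights `w k = ∑ j, ⟪φ k, g j⟫ ^ 2` that lie in
`[0, 1]` and have sum at most `p`. -/
theorem sum_sub_sum_le_norm_sub_sq {B : H →L[ℝ] K →L[ℝ] X}
    (hB : ∀ g f g' f', ⟪B g f, B g' f'⟫_ℝ = ⟪g, g'⟫_ℝ * ⟪f, f'⟫_ℝ)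
    {I J : Finset ℕ} {l : ℕ → ℝ} {φ : ℕ → H} {ψ : ℕ → K} (hl : ∀ k ∈ I, 0 ≤ l k)
    (hφ : Orthonormal ℝ fun k : I => φ k) (hψ : Orthonormal ℝ fun k : I => ψ k)
    {p : ℕ} {c : ℝ} (hJI : J ⊆ I)
    (hcard : J.card = p) (hc0 : 0 ≤ c) (hcJ : ∀ k ∈ J, c ≤ l k) (hcI : ∀ k ∈ I \ J, l k ≤ c)
    (a : Fin p → ℝ) {f : Fin p → K} {g : Fin p → H} (hf : Orthonormal ℝ f)
    (hg : Orthonormal ℝ g) :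
    ∑ k ∈ I, l k - ∑ k ∈ J, l k ≤
      ‖∑ k ∈ I, √(l k) • B (φ k) (ψ k) - ∑ j, a j • B (g j) (f j)‖ ^ 2 := by
  set x := ∑ k ∈ I, √(l k) • B (φ k) (ψ k) with hx
  have hxn : ‖x‖ ^ 2 = ∑ k ∈ I, l k := norm_sq_sum_sqrt_smul hl (orthonormal_bilin hB hφ hψ)
  have hhn : ‖∑ j, a j • B (g j) (f j)‖ ^ 2 = ∑ j, a j ^ 2 := by
    rw [← real_inner_self_eq_norm_sq, (orthonormal_bilin hB hg hf).inner_sum]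
    simp [sq]
  have hxh : ⟪x, ∑ j, a j • B (g j) (f j)⟫_ℝ = ∑ j, a j * ⟪x, B (g j) (f j)⟫_ℝ := by
    simp [inner_sum, real_inner_smul_right]
  have hcs : ∀ j, ⟪x, B (g j) (f j)⟫_ℝ ^ 2 ≤ ∑ k ∈ I, l k * ⟪φ k, g j⟫_ℝ ^ 2 := by
    intro j
    have h1 : ⟪x, B (g j) (f j)⟫_ℝ =
        ∑ k ∈ I, (√(l k) * ⟪φ k, g j⟫_ℝ) * ⟪ψ k, f j⟫_ℝ := by
      simp [hx, sum_inner, real_inner_smul_left, hB, mul_assoc]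
    have h2 : ∑ k ∈ I, ⟪ψ k, f j⟫_ℝ ^ 2 ≤ 1 := by
      have := hψ.sum_inner_products_le (f j) (s := Finset.univ)
      rw [hf.1 j, Finset.sum_coe_sort I (fun k => ‖⟪ψ k, f j⟫_ℝ‖ ^ 2)] at this
      simpa using this
    have h3 : ∑ k ∈ I, (√(l k) * ⟪φ k, g j⟫_ℝ) ^ 2 = ∑ k ∈ I, l k * ⟪φ k, g j⟫_ℝ ^ 2 :=
      Finset.sum_congr rfl fun k hk => by rw [mul_pow, Real.sq_sqrt (hl k hk)]
    rw [h1, ← h3]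
    refine (Finset.sum_mul_sq_le_sq_mul_sq _ _ _).trans ?_
    exact mul_le_of_le_one_right (Finset.sum_nonneg fun k _ => sq_nonneg _) h2
  have hw : ∑ j, ⟪x, B (g j) (f j)⟫_ℝ ^ 2 ≤ ∑ k ∈ J, l k := by
    calc _ ≤ ∑ j, ∑ k ∈ I, l k * ⟪φ k, g j⟫_ℝ ^ 2 := Finset.sum_le_sum fun j _ => hcs j
      _ = ∑ k ∈ I, l k * ∑ j, ⟪φ k, g j⟫_ℝ ^ 2 := by
        rw [Finset.sum_comm]; simp only [Finset.mul_sum]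
      _ ≤ _ := by
        refine sum_mul_le_sum_of_weights hJI (fun k _ => Finset.sum_nonneg fun j _ =>
          sq_nonneg _) (fun k hk => ?_) ?_ hcard hc0 hcJ hcI
        · have := hg.sum_inner_products_le (φ k) (s := Finset.univ)
          rw [hφ.1 ⟨k, hk⟩] at this
          simpa [real_inner_comm] using this
        · rw [Finset.sum_comm]
          calc _ ≤ ∑ _j : Fin p, (1 : ℝ) := Finset.sum_le_sum fun j _ => by
                have := hφ.sum_inner_products_le (g j) (s := Finset.univ)
                rw [hg.1 j, Finset.sum_coe_sort I (fun k => ‖⟪φ k, g j⟫_ℝ‖ ^ 2)] at this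
                simpa using this
            _ = p := by simp
  have hsq : 0 ≤ ∑ j, (a j - ⟪x, B (g j) (f j)⟫_ℝ) ^ 2 :=
    Finset.sum_nonneg fun j _ => sq_nonneg _
  have hexp : ∑ j, (a j - ⟪x, B (g j) (f j)⟫_ℝ) ^ 2 = ∑ j, a j ^ 2 -
      2 * ∑ j, a j * ⟪x, B (g j) (f j)⟫_ℝ + ∑ j, ⟪x, B (g j) (f j)⟫_ℝ ^ 2 := by
    rw [Finset.mul_sum, ← Finset.sum_sub_distrib, ← Finset.sum_add_distrib]
    exact Finset.sum_congr rfl fun j _ => by ring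
  rw [norm_sub_sq_real, hxn, hhn, hxh]
  linarith

@[simp]
theorem mem_indices {N : ℕ∞} {n k : ℕ} : k ∈ indices N n ↔ k < n ∧ (k : ℕ∞) < N := by
  simp [indices]

theorem indices_mono (N : ℕ∞) : Monotone (indices N) := fun _ _ h k hk => by
  rw [mem_indices] at *
  exact ⟨hk.1.trans_le h, hk.2⟩

theorem orthonormal_indices {N : ℕ∞} {φ : ℕ → H}
    (hφ : Orthonormal ℝ fun k : {k : ℕ // (k : ℕ∞) < N} => φ k) (n : ℕ) :
    Orthonormal ℝ fun k : indices N n => φ k :=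
  hφ.comp (fun k : indices N n => (⟨k, (mem_indices.1 k.2).2⟩ : {k : ℕ // (k : ℕ∞) < N}))
    fun _ _ h => Subtype.ext (Subtype.mk.inj h)

theorem orthonormal_fin {N : ℕ∞} {φ : ℕ → H}
    (hφ : Orthonormal ℝ fun k : {k : ℕ // (k : ℕ∞) < N} => φ k) {m : ℕ}
    (hlt : ∀ k : Fin m, ((k : ℕ) : ℕ∞) < N) : Orthonormal ℝ fun k : Fin m => φ k :=
  hφ.comp (fun k : Fin m => (⟨k, hlt k⟩ : {k : ℕ // (k : ℕ∞) < N}))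
    fun _ _ h => Fin.ext (Subtype.mk.inj h)

/-- The Eckart–Young theorem for a (finite or infinite) singular value expansion. -/
theorem norm_sub_sum_sq_le {B : H →L[ℝ] K →L[ℝ] X}
    (hB : ∀ g f g' f', ⟪B g f, B g' f'⟫_ℝ = ⟪g, g'⟫_ℝ * ⟪f, f'⟫_ℝ)
    {N : ℕ∞} {l : ℕ → ℝ} {φ : ℕ → H} {ψ : ℕ → K} {μ : X}
    (hpos : ∀ k : ℕ, (k : ℕ∞) < N → 0 < l k)
    (hnoninc : ∀ j k : ℕ, j ≤ k → (k : ℕ∞) < N → l k ≤ l j)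
    (hφ : Orthonormal ℝ fun k : {k : ℕ // (k : ℕ∞) < N} => φ k)
    (hψ : Orthonormal ℝ fun k : {k : ℕ // (k : ℕ∞) < N} => ψ k)
    (hμ : Tendsto (fun n => ∑ k ∈ indices N n, √(l k) • B (φ k) (ψ k)) atTop (𝓝 μ))
    {p : ℕ} (a : Fin p → ℝ) {f : Fin p → K} {g : Fin p → H} (hf : Orthonormal ℝ f)
    (hg : Orthonormal ℝ g) :
    ‖μ - ∑ k ∈ indices N p, √(l k) • B (φ k) (ψ k)‖ ^ 2 ≤
      ‖μ - ∑ j, a j • B (g j) (f j)‖ ^ 2 := by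
  set x : ℕ → X := fun n => ∑ k ∈ indices N n, √(l k) • B (φ k) (ψ k) with hx
  have hdiff : ∀ n, p ≤ n → x n - x p =
      ∑ k ∈ indices N n \ indices N p, √(l k) • B (φ k) (ψ k) := fun n hn => by
    rw [sub_eq_iff_eq_add, hx, Finset.sum_sdiff (indices_mono N hn)]
  refine le_of_tendsto_of_tendsto ((hμ.sub_const _).norm.pow 2) ((hμ.sub_const _).norm.pow 2) ?_
  filter_upwards [eventually_ge_atTop p] with n hn
  change ‖x n - x p‖ ^ 2 ≤ ‖x n - _‖ ^ 2
  by_cases hpN : (p : ℕ∞) < N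
  · have hl : ∀ k ∈ indices N n, 0 ≤ l k := fun k hk => (hpos k (mem_indices.1 hk).2).le
    have hcard : (indices N p).card = p := by
      have : indices N p = Finset.range p := by
        ext k
        rw [mem_indices, Finset.mem_range, and_iff_left_iff_imp]
        exact fun hk => lt_trans (by exact_mod_cast hk) hpN
      rw [this, Finset.card_range]
    have horth : Orthonormal ℝ
        fun k : (indices N n \ indices N p : Finset ℕ) => B (φ k) (ψ k) :=
      (orthonormal_bilin hB (orthonormal_indices hφ n) (orthonormal_indices hψ n)).comp
        (fun k : (indices N n \ indices N p : Finset ℕ) =>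
          (⟨k, (Finset.mem_sdiff.1 k.2).1⟩ : indices N n))
        fun _ _ h => Subtype.ext (Subtype.mk.inj h)
    have hle := sum_sub_sum_le_norm_sub_sq hB hl (orthonormal_indices hφ n)
      (orthonormal_indices hψ n) (indices_mono N hn) hcard (hpos p hpN).le
      (fun k hk => hnoninc k p (mem_indices.1 hk).1.le hpN)
      (fun k hk => by
        simp only [Finset.mem_sdiff, mem_indices, not_and] at hk
        exact hnoninc p k (not_lt.1 fun h => hk.2 h hk.1.2) hk.1.2) a hf hg
    refine le_trans (le_of_eq ?_) hle
    rw [hdiff n hn, norm_sq_sum_sqrt_smul (fun k hk => hl k (Finset.mem_sdiff.1 hk).1) horth,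
      eq_sub_iff_add_eq, Finset.sum_sdiff (indices_mono N hn)]
  · -- all terms of the series belong to the truncation
    have : indices N n = indices N p := by
      ext k
      simp only [mem_indices, and_congr_left_iff]
      intro hk
      have : k < p := by exact_mod_cast hk.trans_le (not_lt.1 hpN)
      exact ⟨fun _ => this, fun _ => this.trans_le hn⟩
    have h0 : x n - x p = 0 := by simp only [hx, this, sub_self]
    rw [h0, norm_zero, zero_pow two_ne_zero]
    positivity

/-- In an infinite-dimensional space every finite orthonormal family can be prolonged. -/
theorem exists_orthonormal_extension (hH : ¬ FiniteDimensional ℝ H) {m : ℕ}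
    {φ : ℕ → H} (hφ : Orthonormal ℝ fun k : Fin m => φ k) (n : ℕ) :
    ∃ φ' : ℕ → H, (∀ k < m, φ' k = φ k) ∧ Orthonormal ℝ fun k : Fin (m + n) => φ' k := by
  induction n with
  | zero => exact ⟨φ, fun _ _ => rfl, hφ⟩
  | succ n ih =>
    obtain ⟨φ', h1, h2⟩ := ih
    set V := Submodule.span ℝ (Set.range fun k : Fin (m + n) => φ' k) with hV
    have hfin : FiniteDimensional ℝ V := FiniteDimensional.span_of_finite ℝ (Set.finite_range _)
    have hVtop : Vᗮ ≠ ⊥ := fun h => by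
      rw [Submodule.orthogonal_eq_bot_iff] at h
      rw [h] at hfin
      exact hH (LinearEquiv.finiteDimensional (Submodule.topEquiv (R := ℝ) (M := H)))
    obtain ⟨u, huV, hu0⟩ := Submodule.exists_mem_ne_zero_of_ne_bot hVtop
    obtain ⟨v, hv, hφv⟩ : ∃ v : H, ‖v‖ = 1 ∧ ∀ k < m + n, ⟪φ' k, v⟫_ℝ = 0 :=
      ⟨‖u‖⁻¹ • u, norm_smul_inv_norm (𝕜 := ℝ) hu0, fun k hk =>
        (Submodule.mem_orthogonal _ _).1 (Submodule.smul_mem _ _ huV) _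
          (Submodule.subset_span ⟨⟨k, hk⟩, rfl⟩)⟩
    refine ⟨fun k => if k < m + n then φ' k else v, fun k hk => ?_, ?_⟩
    · simp only [show k < m + n by omega, if_true, h1 k hk]
    · have h2' : ∀ i < m + n, ∀ j < m + n, ⟪φ' i, φ' j⟫_ℝ = if i = j then 1 else 0 := by
        intro i hi j hj
        have := orthonormal_iff_ite.1 h2 ⟨i, hi⟩ ⟨j, hj⟩
        simpa using this
      rw [orthonormal_iff_ite]
      intro i j
      by_cases hi : (i : ℕ) < m + n <;> by_cases hj : (j : ℕ) < m + n
      · simp only [hi, hj, if_true, h2' _ hi _ hj, Fin.ext_iff]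
      · have : i ≠ j := by rintro rfl; exact hj hi
        simp only [hi, hj, if_true, if_false, hφv _ hi, this]
      · have : i ≠ j := by rintro rfl; exact hi hj
        simp only [hi, hj, if_true, if_false, real_inner_comm (φ' j) v, hφv _ hj, this]
      · have : i = j := Fin.ext (by omega)
        simp only [hj, if_true, if_false, this, real_inner_self_eq_norm_sq, hv, one_pow]

end Approximation

/-! ### Sections and contractions of square-integrable kernels -/

section Contraction

variable {α β γ : Type*} [MeasurableSpace α] [MeasurableSpace β] [MeasurableSpace γ]
  {ρ : Measure α} {σ : Measure β} {τ : Measure γ}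

theorem sq_eLpNorm_two {f : α → ℝ} : eLpNorm f 2 ρ ^ 2 = ∫⁻ x, ‖f x‖ₑ ^ 2 ∂ρ := by
  have := eLpNorm_nnreal_pow_eq_lintegral (μ := ρ) (f := f) (p := 2) two_ne_zero
  simpa using this

/-- The Cauchy–Schwarz inequality in `ℝ≥0∞`, which needs no integrability. -/
theorem enorm_integral_mul_sq_le {f g : α → ℝ} (hf : AEMeasurable f ρ) (hg : AEMeasurable g ρ) :
    ‖∫ x, f x * g x ∂ρ‖ₑ ^ 2 ≤ (∫⁻ x, ‖f x‖ₑ ^ 2 ∂ρ) * ∫⁻ x, ‖g x‖ₑ ^ 2 ∂ρ := by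
  have h1 : ‖∫ x, f x * g x ∂ρ‖ₑ ≤ eLpNorm f 2 ρ * eLpNorm g 2 ρ := by
    refine (enorm_integral_le_lintegral_enorm _).trans ?_
    simp only [enorm_mul]
    refine (ENNReal.lintegral_mul_le_Lp_mul_Lq ρ Real.HolderConjugate.two_two hf.enorm
      hg.enorm).trans_eq ?_
    rw [eLpNorm_eq_lintegral_rpow_enorm_toReal two_ne_zero ENNReal.ofNat_ne_top,
      eLpNorm_eq_lintegral_rpow_enorm_toReal two_ne_zero ENNReal.ofNat_ne_top]
    simp
  calc _ ≤ (eLpNorm f 2 ρ * eLpNorm g 2 ρ) ^ 2 := pow_le_pow_left₀ zero_le h1 2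
    _ = _ := by rw [mul_pow, sq_eLpNorm_two, sq_eLpNorm_two]

/-- Contracting two square-integrable kernels along their common variable is continuous in `L²`. -/
theorem eLpNorm_contraction_le [SFinite ρ] [SFinite σ] [SFinite τ] {F : α × γ → ℝ} {G : β × γ → ℝ}
    (hF : Measurable F) (hG : Measurable G) :
    eLpNorm (fun z : α × β => ∫ t, F (z.1, t) * G (z.2, t) ∂τ) 2 (ρ.prod σ) ≤
      eLpNorm F 2 (ρ.prod τ) * eLpNorm G 2 (σ.prod τ) := by
  refine (ENNReal.pow_le_pow_left_iff two_ne_zero).1 ?_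
  rw [mul_pow, sq_eLpNorm_two, sq_eLpNorm_two, sq_eLpNorm_two]
  have hF' : Measurable fun z => ‖F z‖ₑ ^ 2 := hF.enorm.pow_const 2
  have hG' : Measurable fun z => ‖G z‖ₑ ^ 2 := hG.enorm.pow_const 2
  rw [lintegral_prod _ hF'.aemeasurable, lintegral_prod _ hG'.aemeasurable,
    ← lintegral_prod_mul hF'.lintegral_prod_right'.aemeasurable
      hG'.lintegral_prod_right'.aemeasurable]
  exact lintegral_mono fun z => enorm_integral_mul_sq_le
    (hF.comp measurable_prodMk_left).aemeasurable (hG.comp measurable_prodMk_left).aemeasurable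

theorem measurable_contraction [SFinite τ] {F : α × γ → ℝ} {G : β × γ → ℝ}
    (hF : Measurable F) (hG : Measurable G) :
    Measurable fun z : α × β => ∫ t, F (z.1, t) * G (z.2, t) ∂τ := by
  have h : Measurable fun w : (α × β) × γ => F (w.1.1, w.2) * G (w.1.2, w.2) := by fun_prop
  exact h.stronglyMeasurable.integral_prod_right'.measurable

theorem memLp_contraction [SFinite ρ] [SFinite σ] [SFinite τ] {F : α × γ → ℝ} {G : β × γ → ℝ}
    (hF : Measurable F) (hG : Measurable G) (hF2 : MemLp F 2 (ρ.prod τ))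
    (hG2 : MemLp G 2 (σ.prod τ)) :
    MemLp (fun z : α × β => ∫ t, F (z.1, t) * G (z.2, t) ∂τ) 2 (ρ.prod σ) :=
  ⟨(measurable_contraction hF hG).aestronglyMeasurable,
    (eLpNorm_contraction_le hF hG).trans_lt (ENNReal.mul_lt_top hF2.2 hG2.2)⟩

theorem memLp_integral_mul [SFinite τ] {F : α × γ → ℝ} {g : γ → ℝ}
    (hF : Measurable F) (hg : Measurable g) (hF2 : MemLp F 2 (ρ.prod τ)) (hg2 : MemLp g 2 τ) :
    MemLp (fun s => ∫ t, F (s, t) * g t ∂τ) 2 ρ := by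
  have hm : Measurable fun s => ∫ t, F (s, t) * g t ∂τ := by
    have h : Measurable fun w : α × γ => F w * g w.2 := by fun_prop
    exact h.stronglyMeasurable.integral_prod_right'.measurable
  refine ⟨hm.aestronglyMeasurable, ?_⟩
  have h : eLpNorm (fun s => ∫ t, F (s, t) * g t ∂τ) 2 ρ ≤
      eLpNorm F 2 (ρ.prod τ) * eLpNorm g 2 τ := by
    refine (ENNReal.pow_le_pow_left_iff two_ne_zero).1 ?_
    rw [mul_pow, sq_eLpNorm_two, sq_eLpNorm_two, sq_eLpNorm_two]
    have hF' : Measurable fun z => ‖F z‖ₑ ^ 2 := hF.enorm.pow_const 2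
    rw [lintegral_prod _ hF'.aemeasurable, ← lintegral_mul_const _ hF'.lintegral_prod_right']
    exact lintegral_mono fun s => enorm_integral_mul_sq_le
      (hF.comp measurable_prodMk_left).aemeasurable hg.aemeasurable
  exact h.trans_lt (ENNReal.mul_lt_top hF2.2 hg2.2)

theorem ae_memLp_section [SFinite ρ] [SFinite τ] {F : α × γ → ℝ} (hF : Measurable F)
    (hF2 : MemLp F 2 (ρ.prod τ)) : ∀ᵐ s ∂ρ, MemLp (fun t => F (s, t)) 2 τ := by
  have h := (memLp_two_iff_integrable_sq hF2.1).1 hF2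
  filter_upwards [h.prod_right_ae] with s hs
  exact (memLp_two_iff_integrable_sq
    (hF.comp measurable_prodMk_left).aestronglyMeasurable).2 hs

end Contraction

/-! ### Tensors in `L²(S × T)` -/

section Tensor

variable {S T : Set ℝ}

theorem measurable_coe {α : Type*} [MeasurableSpace α] {ρ : Measure α} (f : Lp ℝ 2 ρ) :
    Measurable f := (Lp.stronglyMeasurable f).measurable

theorem coeFn_tensor (g : L2 S) (f : L2 T) :
    tensor g f =ᵐ[vol₂ S T] fun z => g z.1 * f z.2 := MemLp.coeFn_toLp _

theorem inner_eq_integral {α : Type*} [MeasurableSpace α] {ρ : Measure α} (f g : Lp ℝ 2 ρ) :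
    ⟪f, g⟫_ℝ = ∫ x, f x * g x ∂ρ := by
  rw [L2.inner_def]
  exact integral_congr_ae (Eventually.of_forall fun x => mul_comm (g x) (f x))

theorem inner_tensor_right (κ : L2₂ S T) (g : L2 S) (f : L2 T) :
    ⟪κ, tensor g f⟫_ℝ = ∫ z, κ z * (g z.1 * f z.2) ∂(vol₂ S T) := by
  rw [inner_eq_integral]
  refine integral_congr_ae ?_
  filter_upwards [coeFn_tensor g f] with z hz
  rw [hz]

theorem inner_tensor_tensor (g : L2 S) (f : L2 T) (g' : L2 S) (f' : L2 T) :
    ⟪tensor g f, tensor g' f'⟫_ℝ = ⟪g, g'⟫_ℝ * ⟪f, f'⟫_ℝ := by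
  rw [inner_tensor_right, inner_eq_integral, inner_eq_integral, ← integral_prod_mul]
  refine integral_congr_ae ?_
  filter_upwards [coeFn_tensor g f] with z hz
  rw [hz]; ring

theorem tensor_add_left (g g' : L2 S) (f : L2 T) :
    tensor (g + g') f = tensor g f + tensor g' f := by
  rw [← sub_eq_zero, ← inner_self_eq_zero (𝕜 := ℝ)]
  simp only [inner_sub_left, inner_sub_right, inner_add_left, inner_add_right,
    inner_tensor_tensor]
  ring

theorem tensor_add_right (g : L2 S) (f f' : L2 T) :
    tensor g (f + f') = tensor g f + tensor g f' := by
  rw [← sub_eq_zero, ← inner_self_eq_zero (𝕜 := ℝ)]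
  simp only [inner_sub_left, inner_sub_right, inner_add_left, inner_add_right,
    inner_tensor_tensor]
  ring

theorem tensor_smul_left (c : ℝ) (g : L2 S) (f : L2 T) : tensor (c • g) f = c • tensor g f := by
  rw [← sub_eq_zero, ← inner_self_eq_zero (𝕜 := ℝ)]
  simp only [inner_sub_left, inner_sub_right, real_inner_smul_left, real_inner_smul_right,
    inner_tensor_tensor]
  ring

theorem tensor_smul_right (c : ℝ) (g : L2 S) (f : L2 T) : tensor g (c • f) = c • tensor g f := by
  rw [← sub_eq_zero, ← inner_self_eq_zero (𝕜 := ℝ)]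
  simp only [inner_sub_left, inner_sub_right, real_inner_smul_left, real_inner_smul_right,
    inner_tensor_tensor]
  ring

theorem norm_tensor (g : L2 S) (f : L2 T) : ‖tensor g f‖ = ‖g‖ * ‖f‖ := by
  rw [← sq_eq_sq₀ (norm_nonneg _) (by positivity), mul_pow, ← real_inner_self_eq_norm_sq,
    ← real_inner_self_eq_norm_sq, ← real_inner_self_eq_norm_sq, inner_tensor_tensor]

/-- The tensor product `(g, f) ↦ g(s) f(t)` as a continuous bilinear map. -/
noncomputable def tensorL (S T : Set ℝ) : L2 S →L[ℝ] L2 T →L[ℝ] L2₂ S T :=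
  LinearMap.mkContinuous₂
    (LinearMap.mk₂ ℝ tensor tensor_add_left tensor_smul_left tensor_add_right tensor_smul_right) 1
    fun g f => by rw [one_mul]; exact (norm_tensor g f).le

@[simp]
theorem tensorL_apply (g : L2 S) (f : L2 T) : tensorL S T g f = tensor g f := rfl

/-- A weak identity for an integral operator holds pointwise almost everywhere. -/
theorem ae_integral_mul_eq_of_inner (κ : L2₂ S T) (φ : L2 T) (χ : L2 S)
    (h : ∀ g, ⟪κ, tensor g φ⟫_ℝ = ⟪χ, g⟫_ℝ) :
    ∀ᵐ s ∂(vol S), ∫ u in T, κ (s, u) * φ u = χ s := by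
  have hmem : MemLp (fun s => ∫ u in T, κ (s, u) * φ u) 2 (vol S) :=
    memLp_integral_mul (measurable_coe κ) (measurable_coe φ) (Lp.memLp κ) (Lp.memLp φ)
  have heq : hmem.toLp _ = χ := by
    refine ext_inner_right ℝ fun g => ?_
    rw [← h, inner_eq_integral, inner_tensor_right, integral_prod]
    · refine integral_congr_ae ?_
      filter_upwards [hmem.coeFn_toLp] with s hs
      rw [hs, ← integral_mul_const]
      exact integral_congr_ae (Eventually.of_forall fun u => by ring)
    · exact (Lp.memLp κ).integrable_mul (memLp_tensor g φ)
  filter_upwards [hmem.coeFn_toLp] with s hs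
  rw [← hs, heq]

/-- The functions of separate variables are total in `L²(S × T)`: almost every section of an element
orthogonal to all of them is orthogonal to a dense sequence. -/
theorem eq_zero_of_inner_tensor_eq_zero (κ : L2₂ S T) (h : ∀ g f, ⟪κ, tensor g f⟫_ℝ = 0) :
    κ = 0 := by
  have : Fact ((2 : ℝ≥0∞) ≠ ∞) := ⟨ENNReal.ofNat_ne_top⟩
  have h1 : ∀ n, ∀ᵐ s ∂(vol S),
      ∫ u in T, κ (s, u) * (TopologicalSpace.denseSeq (L2 T) n) u = 0 := by
    intro n
    filter_upwards [ae_integral_mul_eq_of_inner κ (TopologicalSpace.denseSeq (L2 T) n) 0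
      (fun g => by rw [h, inner_zero_left]), Lp.coeFn_zero ℝ 2 (vol S)] with s hs hs'
    rw [hs, hs']; rfl
  rw [Lp.eq_zero_iff_ae_eq_zero]
  have hm : MeasurableSet {z : ℝ × ℝ | κ z = (0 : ℝ × ℝ → ℝ) z} :=
    measurableSet_eq_fun (measurable_coe κ) measurable_zero
  rw [EventuallyEq, Measure.ae_prod_iff_ae_ae hm]
  filter_upwards [ae_all_iff.2 h1, ae_memLp_section (measurable_coe κ) (Lp.memLp κ)] with s hs hκs
  have hz : hκs.toLp _ = 0 := by
    refine (TopologicalSpace.denseRange_denseSeq (L2 T)).induction_on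
      (p := fun f => ⟪hκs.toLp _, f⟫_ℝ = 0) _ (isClosed_eq (by fun_prop) continuous_const)
      (fun n => ?_) |> inner_self_eq_zero.1
    rw [inner_eq_integral, ← hs n]
    refine integral_congr_ae ?_
    filter_upwards [hκs.coeFn_toLp] with u hu
    rw [hu]
  rw [Lp.eq_zero_iff_ae_eq_zero] at hz
  exact hκs.coeFn_toLp.symm.trans hz

/-- The indicators of infinitely many disjoint open intervals inside `S`, which accumulate at a
point, are nonzero and mutually orthogonal. -/
theorem not_finiteDimensional_L2 (hS : S.OrdConnected) (hS' : S.Nontrivial) :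
    ¬ FiniteDimensional ℝ (L2 S) := by
  obtain ⟨a, ha, b, hb, hab⟩ := hS'.exists_lt
  have hsub : Set.Icc a b ⊆ S := hS.out ha hb
  set x : ℕ → ℝ := fun n => a + (b - a) / (n + 1) with hx
  have hanti : StrictAnti x := strictAnti_nat_of_succ_lt fun n => by
    have : 0 < b - a := sub_pos.2 hab
    simp only [hx, Nat.cast_succ]
    gcongr
    linarith
  set s : ℕ → Set ℝ := fun n => Set.Ioo (x (n + 1)) (x n) with hs
  have hsm : ∀ n, MeasurableSet (s n) := fun n => measurableSet_Ioo
  have hsS : ∀ n, s n ⊆ S := fun n y hy => hsub ⟨by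
      have : a ≤ x (n + 1) := le_add_of_nonneg_right (by
        have := sub_pos.2 hab; positivity)
      exact this.trans hy.1.le, by
      have h0 : x n ≤ x 0 := hanti.antitone n.zero_le
      have h1 : x 0 = b := by simp [hx]
      exact hy.2.le.trans (h0.trans_eq h1)⟩
  have hvol : ∀ n, vol S (s n) = ENNReal.ofReal (x n - x (n + 1)) := fun n => by
    rw [Measure.restrict_apply (hsm n), Set.inter_eq_left.2 (hsS n), Real.volume_Ioo]
  have hfin : ∀ n, vol S (s n) ≠ ∞ := fun n => by rw [hvol]; exact ENNReal.ofReal_ne_top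
  have hli : LinearIndependent ℝ fun n => (indicatorConstLp 2 (hsm n) (hfin n) (1 : ℝ) : L2 S) := by
    refine linearIndependent_of_ne_zero_of_inner_eq_zero (𝕜 := ℝ) (fun n h0 => ?_)
      fun i j hij => ?_
    · have h := L2.real_inner_indicatorConstLp_one_indicatorConstLp_one (hsm n) (hsm n)
        (hfin n) (hfin n)
      rw [h0, inner_zero_left, Set.inter_self, Measure.real, hvol, ENNReal.toReal_ofReal
        (sub_nonneg.2 (hanti n.lt_succ_self).le)] at h
      exact (sub_pos.2 (hanti n.lt_succ_self)).ne h
    · have h := L2.real_inner_indicatorConstLp_one_indicatorConstLp_one (hsm i) (hsm j)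
        (hfin i) (hfin j)
      have hd : Disjoint (s i) (s j) := hanti.antitone.pairwise_disjoint_on_Ioo_succ hij
      rwa [hd.inter_eq, measureReal_empty] at h
  intro hfd
  exact not_finite_iff_infinite.2 inferInstance hli.finite

end Tensor

/-! ### Expansions of kernels and the decomposition -/

section Kernel

variable {S T : Set ℝ} {N : ℕ∞} {l : ℕ → ℝ} {φ : ℕ → L2 S} {ψ : ℕ → L2 T}

theorem coeFn_sum_tensor (I : Finset ℕ) (c : ℕ → ℝ) (φ : ℕ → L2 S) (ψ : ℕ → L2 T) :
    ⇑(∑ k ∈ I, c k • tensor (φ k) (ψ k)) =ᵐ[vol₂ S T]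
      fun z => ∑ k ∈ I, c k * φ k z.1 * ψ k z.2 := by
  have h : ∀ k, ∀ᵐ z ∂(vol₂ S T),
      (c k • tensor (φ k) (ψ k) : L2₂ S T) z = c k * φ k z.1 * ψ k z.2 := fun k => by
    filter_upwards [Lp.coeFn_smul (c k) (tensor (φ k) (ψ k)), coeFn_tensor (φ k) (ψ k)]
      with z hz hz'
    rw [hz, Pi.smul_apply, hz', smul_eq_mul, mul_assoc]
  filter_upwards [Lp.coeFn_finsetSum I fun k => c k • tensor (φ k) (ψ k), ae_all_iff.2 h]
    with z hz hz'
  rw [hz, Finset.sum_apply]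
  exact Finset.sum_congr rfl fun k _ => hz' k

theorem tendsto_sum_tensor_iff (κ : L2₂ S T) (c : ℕ → ℝ) (φ : ℕ → L2 S) (ψ : ℕ → L2 T) :
    Tendsto (fun n => ∑ k ∈ indices N n, c k • tensor (φ k) (ψ k)) atTop (𝓝 κ) ↔
      Tendsto (fun n => eLpNorm (fun z : ℝ × ℝ =>
        κ z - ∑ k ∈ indices N n, c k * φ k z.1 * ψ k z.2) 2 (vol₂ S T)) atTop (𝓝 0) := by
  rw [Lp.tendsto_Lp_iff_tendsto_eLpNorm']
  refine tendsto_congr fun n => ?_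
  rw [eLpNorm_sub_comm]
  refine eLpNorm_congr_ae ?_
  filter_upwards [coeFn_sum_tensor (indices N n) c φ ψ] with z hz
  rw [Pi.sub_apply, hz]

/-- If the singular expansions of `F` converge in `L²`, then so do the expansions of the kernel
`∫ F(s₁, t) F(s₂, t) dt`: contraction is a continuous bilinear operation, and on finite expansions
it is evaluated by orthonormality of the `ψ k`. -/
theorem tendsto_eLpNorm_kernel_sub {F : ℝ × ℝ → ℝ} (hF : Measurable F)
    (hF2 : MemLp F 2 (vol₂ S T)) (hl : ∀ k : ℕ, (k : ℕ∞) < N → 0 ≤ l k)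
    (hψ : Orthonormal ℝ fun k : {k : ℕ // (k : ℕ∞) < N} => ψ k)
    (hlim : Tendsto (fun n => eLpNorm (fun z : ℝ × ℝ =>
      F z - ∑ k ∈ indices N n, √(l k) * φ k z.1 * ψ k z.2) 2 (vol₂ S T)) atTop (𝓝 0)) :
    Tendsto (fun n => eLpNorm (fun z : ℝ × ℝ => (∫ t in T, F (z.1, t) * F (z.2, t)) -
      ∑ k ∈ indices N n, l k * φ k z.1 * φ k z.2) 2 (vol₂ S S)) atTop (𝓝 0) := by
  set G : ℕ → ℝ × ℝ → ℝ := fun n z => ∑ k ∈ indices N n, √(l k) * φ k z.1 * ψ k z.2 with hG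
  have hφm : ∀ k, Measurable (φ k) := fun k => measurable_coe (φ k)
  have hψm : ∀ k, Measurable (ψ k) := fun k => measurable_coe (ψ k)
  have hGm : ∀ n, Measurable (G n) := fun n => by
    refine Finset.measurable_sum _ fun k _ => ?_
    exact ((hφm k).comp measurable_fst).const_mul _ |>.mul ((hψm k).comp measurable_snd)
  have hGs : ∀ n s, MemLp (fun t => G n (s, t)) 2 (vol T) := fun n s =>
    memLp_finsetSum _ fun k _ => (Lp.memLp (ψ k)).const_mul (√(l k) * φ k s)
  set D : ℕ → ℝ × ℝ → ℝ := fun n z => F z - G n z with hD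
  have hDm : ∀ n, Measurable (D n) := fun n => hF.sub (hGm n)
  have hGG : ∀ n s₁ s₂, ∫ t in T, G n (s₁, t) * G n (s₂, t) =
      ∑ k ∈ indices N n, l k * φ k s₁ * φ k s₂ := by
    intro n s₁ s₂
    have hint : ∀ i j, Integrable (fun t => √(l i) * φ i s₁ * ψ i t * (√(l j) * φ j s₂ * ψ j t))
        (vol T) := fun i j =>
      ((Lp.memLp (ψ i)).const_mul _).integrable_mul ((Lp.memLp (ψ j)).const_mul _)
    simp only [hG, Finset.sum_mul_sum]
    rw [integral_finsetSum _ fun i _ => integrable_finsetSum _ fun j _ => hint i j]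
    refine Finset.sum_congr rfl fun i hi => ?_
    rw [integral_finsetSum _ fun j _ => hint i j]
    have hterm : ∀ j ∈ indices N n,
        ∫ t in T, √(l i) * φ i s₁ * ψ i t * (√(l j) * φ j s₂ * ψ j t) =
          if i = j then l i * φ i s₁ * φ i s₂ else 0 := by
      intro j hj
      have h1 : ∫ t in T, √(l i) * φ i s₁ * ψ i t * (√(l j) * φ j s₂ * ψ j t) =
          √(l i) * √(l j) * φ i s₁ * φ j s₂ * ⟪ψ i, ψ j⟫_ℝ := by
        rw [inner_eq_integral, ← integral_const_mul]
        exact integral_congr_ae (Eventually.of_forall fun t => by ring)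
      have h2 := orthonormal_iff_ite.1 hψ ⟨i, (mem_indices.1 hi).2⟩ ⟨j, (mem_indices.1 hj).2⟩
      simp only [Subtype.mk.injEq] at h2
      rw [h1, h2]
      split_ifs with hij
      · subst hij
        rw [Real.mul_self_sqrt (hl i (mem_indices.1 hi).2), mul_one]
      · rw [mul_zero]
    rw [Finset.sum_congr rfl hterm, Finset.sum_ite_eq, if_pos hi]
  have hFs := ae_memLp_section hF hF2
  have hdecomp : ∀ n, (fun z : ℝ × ℝ => (∫ t in T, F (z.1, t) * F (z.2, t)) -
      ∑ k ∈ indices N n, l k * φ k z.1 * φ k z.2) =ᵐ[vol₂ S S]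
      (fun z : ℝ × ℝ => ∫ t in T, D n (z.1, t) * F (z.2, t)) +
        fun z : ℝ × ℝ => ∫ t in T, G n (z.1, t) * D n (z.2, t) := by
    intro n
    filter_upwards [Measure.quasiMeasurePreserving_fst.ae hFs,
      Measure.quasiMeasurePreserving_snd.ae hFs] with z h1 h2
    have hD1 : MemLp (fun t => D n (z.1, t)) 2 (vol T) := h1.sub (hGs n z.1)
    have hD2 : MemLp (fun t => D n (z.2, t)) 2 (vol T) := h2.sub (hGs n z.2)
    have i1 : Integrable (fun t => F (z.1, t) * F (z.2, t)) (vol T) := h1.integrable_mul h2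
    have i2 : Integrable (fun t => G n (z.1, t) * G n (z.2, t)) (vol T) :=
      (hGs n z.1).integrable_mul (hGs n z.2)
    have i3 : Integrable (fun t => D n (z.1, t) * F (z.2, t)) (vol T) := hD1.integrable_mul h2
    have i4 : Integrable (fun t => G n (z.1, t) * D n (z.2, t)) (vol T) :=
      (hGs n z.1).integrable_mul hD2
    rw [Pi.add_apply, ← hGG, ← integral_sub i1 i2, ← integral_add i3 i4]
    exact integral_congr_ae (Eventually.of_forall fun t => by simp only [hD]; ring)
  have hle : ∀ n, eLpNorm (fun z : ℝ × ℝ => (∫ t in T, F (z.1, t) * F (z.2, t)) -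
      ∑ k ∈ indices N n, l k * φ k z.1 * φ k z.2) 2 (vol₂ S S) ≤
      eLpNorm (D n) 2 (vol₂ S T) * eLpNorm F 2 (vol₂ S T) +
        (eLpNorm F 2 (vol₂ S T) + eLpNorm (D n) 2 (vol₂ S T)) * eLpNorm (D n) 2 (vol₂ S T) := by
    intro n
    rw [eLpNorm_congr_ae (hdecomp n)]
    refine (eLpNorm_add_le (measurable_contraction (hDm n) hF).aestronglyMeasurable
      (measurable_contraction (hGm n) (hDm n)).aestronglyMeasurable one_le_two).trans ?_
    refine add_le_add (eLpNorm_contraction_le (hDm n) hF)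
      ((eLpNorm_contraction_le (hGm n) (hDm n)).trans ?_)
    gcongr
    have h : G n = F - D n := by ext z; simp [hD]
    rw [h]
    exact eLpNorm_sub_le hF.aestronglyMeasurable (hDm n).aestronglyMeasurable one_le_two
  have hFfin : eLpNorm F 2 (vol₂ S T) ≠ ∞ := hF2.2.ne
  refine tendsto_of_tendsto_of_tendsto_of_le_of_le tendsto_const_nhds ?_
    (fun n => zero_le) hle
  have h1 : Tendsto (fun n => eLpNorm (D n) 2 (vol₂ S T) * eLpNorm F 2 (vol₂ S T)) atTop
      (𝓝 (0 * eLpNorm F 2 (vol₂ S T))) := ENNReal.Tendsto.mul_const hlim (Or.inr hFfin)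
  have h2 : Tendsto (fun n => eLpNorm F 2 (vol₂ S T) + eLpNorm (D n) 2 (vol₂ S T)) atTop
      (𝓝 (eLpNorm F 2 (vol₂ S T) + 0)) := tendsto_const_nhds.add hlim
  have h3 := h1.add (ENNReal.Tendsto.mul h2 (Or.inr ENNReal.zero_ne_top) hlim
    (Or.inr (by rwa [add_zero])))
  simpa using h3

/-- The eigenvalue equations are consequences of the kernel expansion and of orthonormality. -/
theorem eigenEq_of_tendsto {k₁ : ℝ → ℝ → ℝ} (hk : MemLp (fun z : ℝ × ℝ => k₁ z.1 z.2) 2 (vol₂ S S))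
    (hφ : Orthonormal ℝ fun k : {k : ℕ // (k : ℕ∞) < N} => φ k)
    (hlim : Tendsto (fun n => eLpNorm (fun z : ℝ × ℝ =>
      k₁ z.1 z.2 - ∑ k ∈ indices N n, l k * φ k z.1 * φ k z.2) 2 (vol₂ S S)) atTop (𝓝 0))
    {k : ℕ} (hkN : (k : ℕ∞) < N) : EigenEq k₁ (l k) (φ k) := by
  set κ : L2₂ S S := hk.toLp _ with hκ
  have hcoe : κ =ᵐ[vol₂ S S] fun z => k₁ z.1 z.2 := hk.coeFn_toLp
  have hκlim : Tendsto (fun n => ∑ j ∈ indices N n, l j • tensor (φ j) (φ j)) atTop (𝓝 κ) := by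
    rw [tendsto_sum_tensor_iff]
    refine hlim.congr fun n => eLpNorm_congr_ae ?_
    filter_upwards [hcoe] with z hz
    rw [hz]
  have hinner : ∀ g, ⟪κ, tensor g (φ k)⟫_ℝ = ⟪l k • φ k, g⟫_ℝ := by
    intro g
    refine tendsto_nhds_unique (hκlim.inner tendsto_const_nhds) ?_
    refine tendsto_const_nhds.congr' ?_
    filter_upwards [eventually_gt_atTop k] with n hn
    have hmem : k ∈ indices N n := mem_indices.2 ⟨hn, hkN⟩
    rw [sum_inner, Finset.sum_eq_single_of_mem k hmem]
    · rw [real_inner_smul_left, real_inner_smul_left, inner_tensor_tensor,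
        real_inner_self_eq_norm_sq (φ k), hφ.1 ⟨k, hkN⟩]
      ring
    · intro j hj hjk
      have : ⟪φ j, φ k⟫_ℝ = 0 := hφ.2 (i := ⟨j, (mem_indices.1 hj).2⟩) (j := ⟨k, hkN⟩)
        fun h => hjk (Subtype.mk.inj h)
      rw [real_inner_smul_left, inner_tensor_tensor, this, mul_zero, mul_zero]
  filter_upwards [ae_integral_mul_eq_of_inner κ (φ k) (l k • φ k) hinner,
    Measure.ae_ae_of_ae_prod hcoe, Lp.coeFn_smul (l k) (φ k)] with s hs hs' hs''
  rw [hs'', Pi.smul_apply, smul_eq_mul] at hs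
  rw [← hs]
  refine integral_congr_ae ?_
  filter_upwards [hs'] with u hu
  rw [hu]

theorem memLp_comp_swap (μ : L2₂ S T) : MemLp (fun z : ℝ × ℝ => μ (z.2, z.1)) 2 (vol₂ T S) :=
  (Lp.memLp μ).comp_measurePreserving Measure.measurePreserving_swap

theorem eLpNorm_swap_sub (μ : L2₂ S T) (I : Finset ℕ) (c : ℕ → ℝ) :
    eLpNorm (fun z : ℝ × ℝ => μ (z.2, z.1) - ∑ k ∈ I, c k * ψ k z.1 * φ k z.2) 2 (vol₂ T S) =
      eLpNorm (fun z : ℝ × ℝ => μ z - ∑ k ∈ I, c k * φ k z.1 * ψ k z.2) 2 (vol₂ S T) := by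
  have hm : Measurable fun z : ℝ × ℝ => μ z - ∑ k ∈ I, c k * φ k z.1 * ψ k z.2 := by
    refine (measurable_coe μ).sub (Finset.measurable_sum _ fun k _ => ?_)
    exact (((measurable_coe (φ k)).comp measurable_fst).const_mul _).mul
      ((measurable_coe (ψ k)).comp measurable_snd)
  rw [← eLpNorm_comp_measurePreserving hm.aestronglyMeasurable
    (Measure.measurePreserving_swap (μ := vol T) (ν := vol S))]
  refine congrArg (fun f => eLpNorm f 2 (vol₂ T S)) (funext fun z => ?_)
  simp only [Function.comp_apply, Prod.swap]
  congr 1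
  exact Finset.sum_congr rfl fun k _ => by ring

/-- An expansion in `L²(S × T)` with orthonormal factors is already a functional singular value
decomposition. -/
theorem isFSVD_of_tendsto {μ : L2₂ S T} (hpos : ∀ k : ℕ, (k : ℕ∞) < N → 0 < l k)
    (hnoninc : ∀ j k : ℕ, j ≤ k → (k : ℕ∞) < N → l k ≤ l j)
    (hφ : Orthonormal ℝ fun k : {k : ℕ // (k : ℕ∞) < N} => φ k)
    (hψ : Orthonormal ℝ fun k : {k : ℕ // (k : ℕ∞) < N} => ψ k)
    (hlim : Tendsto (truncation N l φ ψ) atTop (𝓝 μ)) : IsFSVD μ N l φ ψ := by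
  have hl : ∀ k : ℕ, (k : ℕ∞) < N → 0 ≤ l k := fun k hk => (hpos k hk).le
  have hlim' : Tendsto (fun n => eLpNorm (fun z : ℝ × ℝ =>
      μ z - ∑ k ∈ indices N n, √(l k) * φ k z.1 * ψ k z.2) 2 (vol₂ S T)) atTop (𝓝 0) :=
    (tendsto_sum_tensor_iff μ (fun k => √(l k)) φ ψ).1 hlim
  have hμ : Measurable fun z : ℝ × ℝ => μ (z.2, z.1) := (measurable_coe μ).comp measurable_swap
  have hk₁ : Tendsto (fun n => eLpNorm (fun z : ℝ × ℝ =>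
      kernel₁ μ z.1 z.2 - ∑ k ∈ indices N n, l k * φ k z.1 * φ k z.2) 2 (vol₂ S S))
      atTop (𝓝 0) :=
    tendsto_eLpNorm_kernel_sub (measurable_coe μ) (Lp.memLp μ) hl hψ hlim'
  have hswap : Tendsto (fun n => eLpNorm (fun z : ℝ × ℝ =>
      μ (z.2, z.1) - ∑ k ∈ indices N n, √(l k) * ψ k z.1 * φ k z.2) 2 (vol₂ T S))
      atTop (𝓝 0) :=
    hlim'.congr fun n => (eLpNorm_swap_sub μ (indices N n) fun k => √(l k)).symm
  have hk₂ : Tendsto (fun n => eLpNorm (fun z : ℝ × ℝ =>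
      kernel₂ μ z.1 z.2 - ∑ k ∈ indices N n, l k * ψ k z.1 * ψ k z.2) 2 (vol₂ T T))
      atTop (𝓝 0) :=
    tendsto_eLpNorm_kernel_sub (F := fun z : ℝ × ℝ => μ (z.2, z.1)) (φ := ψ) (ψ := φ) hμ (memLp_comp_swap μ) hl hφ hswap
  have hm₁ : MemLp (fun z : ℝ × ℝ => kernel₁ μ z.1 z.2) 2 (vol₂ S S) :=
    memLp_contraction (measurable_coe μ) (measurable_coe μ) (Lp.memLp μ) (Lp.memLp μ)
  have hm₂ : MemLp (fun z : ℝ × ℝ => kernel₂ μ z.1 z.2) 2 (vol₂ T T) :=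
    memLp_contraction hμ hμ (memLp_comp_swap μ) (memLp_comp_swap μ)
  exact
    { pos := hpos
      noninc := hnoninc
      orthonormal_left := hφ
      orthonormal_right := hψ
      eigen_left := fun k hk => eigenEq_of_tendsto hm₁ hφ hk₁ hk
      eigen_right := fun k hk => eigenEq_of_tendsto hm₂ hψ hk₂ hk
      expansion_kernel₁ := hk₁
      expansion_kernel₂ := hk₂
      expansion := hlim }

theorem exists_isFSVD (μ : L2₂ S T) :
    ∃ (N : ℕ∞) (l : ℕ → ℝ) (φ : ℕ → L2 S) (ψ : ℕ → L2 T), IsFSVD μ N l φ ψ := by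
  obtain ⟨σ, φ, ψ, hσ0, hanti, hnorm, horth, hlim⟩ := exists_singular_expansion (tensorL S T)
    inner_tensor_tensor eq_zero_of_inner_tensor_eq_zero μ
  -- the number of terms is the first index, if any, with `σ k = 0`
  obtain ⟨N, hN⟩ : ∃ N : ℕ∞, ∀ k : ℕ, (k : ℕ∞) < N ↔ 0 < σ k := by
    by_cases h : ∃ k, σ k = 0
    · classical
      refine ⟨(Nat.find h : ℕ), fun k => ?_⟩
      rw [Nat.cast_lt]
      constructor
      · exact fun hk => (hσ0 k).lt_of_ne' (Nat.find_min h hk)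
      · intro hk
        by_contra! hle
        exact (hk.trans_le (hanti hle)).ne' (Nat.find_spec h)
    · push Not at h
      exact ⟨⊤, fun k => ⟨fun _ => (hσ0 k).lt_of_ne' (h k), fun _ => ENat.natCast_lt_top k⟩⟩
  refine ⟨N, fun k => σ k ^ 2, φ, ψ, isFSVD_of_tendsto (fun k hk => ?_) (fun j k hjk _ => ?_)
    ⟨fun k => (hnorm k ((hN k).1 k.2)).1, fun i j hij => ?_⟩
    ⟨fun k => (hnorm k ((hN k).1 k.2)).2, fun i j hij => ?_⟩ ?_⟩
  · have := (hN k).1 hk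
    positivity
  · exact pow_le_pow_left₀ (hσ0 k) (hanti hjk) 2
  · rcases lt_or_gt_of_ne fun h => hij (Subtype.ext h) with h | h
    · exact (horth _ _ h ((hN _).1 j.2)).1
    · rw [real_inner_comm]
      exact (horth _ _ h ((hN _).1 i.2)).1
  · rcases lt_or_gt_of_ne fun h => hij (Subtype.ext h) with h | h
    · exact (horth _ _ h ((hN _).1 j.2)).2
    · rw [real_inner_comm]
      exact (horth _ _ h ((hN _).1 i.2)).2
  · refine hlim.congr fun n => ?_
    rw [truncation, indices, Finset.sum_filter]
    refine Finset.sum_congr rfl fun k _ => ?_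
    rw [Real.sqrt_sq (hσ0 k), tensorL_apply]
    split_ifs with h
    · rfl
    · rw [le_antisymm (not_lt.1 (mt (hN k).2 h)) (hσ0 k), zero_smul]

/-- If there are fewer than `p` terms, the orthonormal systems are prolonged to length `p`, and the
new terms get the coefficient `0`. -/
theorem truncation_mem_separable (hS : ¬ FiniteDimensional ℝ (L2 S))
    (hT : ¬ FiniteDimensional ℝ (L2 T))
    (hφ : Orthonormal ℝ fun k : {k : ℕ // (k : ℕ∞) < N} => φ k)
    (hψ : Orthonormal ℝ fun k : {k : ℕ // (k : ℕ∞) < N} => ψ k) (p : ℕ) :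
    truncation N l φ ψ p ∈ separable S T p := by
  obtain ⟨m, r, hmr, hm⟩ : ∃ m r : ℕ, m + r = p ∧ indices N p = Finset.range m := by
    rcases le_total (p : ℕ∞) N with h | h
    · refine ⟨p, 0, rfl, ?_⟩
      ext k
      rw [mem_indices, Finset.mem_range, and_iff_left_iff_imp]
      exact fun hk => lt_of_lt_of_le (by exact_mod_cast hk) h
    · lift N to ℕ using ne_top_of_le_ne_top (ENat.natCast_ne_top p) h
      have h' : N ≤ p := by exact_mod_cast h
      refine ⟨N, p - N, by omega, ?_⟩
      ext k
      rw [mem_indices, Finset.mem_range, Nat.cast_lt]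
      omega
  subst hmr
  have hlt : ∀ k : Fin m, ((k : ℕ) : ℕ∞) < N := fun k =>
    (mem_indices.1 (hm ▸ Finset.mem_range.2 k.2 : (k : ℕ) ∈ indices N (m + r))).2
  have hφm := orthonormal_fin hφ hlt
  have hψm := orthonormal_fin hψ hlt
  obtain ⟨φ', hφ', hφo⟩ := exists_orthonormal_extension hS hφm r
  obtain ⟨ψ', hψ', hψo⟩ := exists_orthonormal_extension hT hψm r
  refine ⟨fun k => if (k : ℕ) < m then √(l k) else 0, fun k => ψ' k, fun k => φ' k, hψo, hφo, ?_⟩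
  rw [truncation, hm,
    Fin.sum_univ_eq_sum_range
      (fun k => (if k < m then √(l k) else 0) • tensor (φ' k) (ψ' k)) (m + r),
    Finset.sum_range_add, Finset.sum_eq_zero (s := Finset.range r), add_zero]
  · refine Finset.sum_congr rfl fun k hk => ?_
    have hk' := Finset.mem_range.1 hk
    rw [if_pos hk', hφ' k hk', hψ' k hk']
  · intro k _
    rw [if_neg (by omega), zero_smul]

end Kernel
end FSVD

theorem theorem2 (S T : Set ℝ)
    (hS : IsClosed S) (hS' : S.OrdConnected) (hS'' : S.Nontrivial)
    (hT : IsClosed T) (hT' : T.OrdConnected) (hT'' : T.Nontrivial)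
    (μ : FSVD.L2₂ S T) :
    (∃ (N : ℕ∞) (l : ℕ → ℝ) (φ : ℕ → FSVD.L2 S) (ψ : ℕ → FSVD.L2 T), FSVD.IsFSVD μ N l φ ψ) ∧
    ∀ (N : ℕ∞) (l : ℕ → ℝ) (φ : ℕ → FSVD.L2 S) (ψ : ℕ → FSVD.L2 T), FSVD.IsFSVD μ N l φ ψ →
      ∀ p : ℕ,
        FSVD.truncation N l φ ψ p ∈ FSVD.separable S T p ∧
        IsLeast ((fun h : FSVD.L2₂ S T => ‖μ - h‖ ^ 2) '' FSVD.separable S T p)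
          (‖μ - FSVD.truncation N l φ ψ p‖ ^ 2) := by
  refine ⟨FSVD.exists_isFSVD μ, fun N l φ ψ h p => ?_⟩
  have hmem : FSVD.truncation N l φ ψ p ∈ FSVD.separable S T p :=
    FSVD.truncation_mem_separable (FSVD.not_finiteDimensional_L2 hS' hS'')
      (FSVD.not_finiteDimensional_L2 hT' hT'') h.orthonormal_left h.orthonormal_right p
  refine ⟨hmem, ⟨_, hmem, rfl⟩, ?_⟩
  rintro _ ⟨_, ⟨a, f, g, hf, hg, rfl⟩, rfl⟩
  exact FSVD.norm_sub_sum_sq_le (B := FSVD.tensorL S T) FSVD.inner_tensor_tensor h.pos h.noninc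
    h.orthonormal_left h.orthonormal_right h.expansion a hf hg
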